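/- Let $\mathbb H^3$ be hyperbolic 3-space with metric $g=\langle\cdot,\cdot\rangle$ and Levi-Civita connection $\nabla$ (in the hyperboloid model, $\mathbb H^3=\{x\in\mathbb R^{1,3}:\langle x,x\rangle=-1,\ x_0>0\}$). Let $I\subseteq\mathbb R$ be an open interval, $\alpha:I\to\mathbb H^3$ a smooth immersed curve ($\alpha'(s)\neq 0$ for all $s\in I$), and $N$ a smooth unit normal vector field along $\alpha$, that is, $N(s)\in T_{\alpha(s)}\mathbb H^3$, $\langle N(s),N(s)\rangle=1$ and $\langle N(s),\alpha'(s)\rangle=0$. Let $f(s,\lambda)=\gamma_{N(s)}(\lambda)$, $(s,\lambda)\in I\times\mathbb R$, be the ruled surface defined by $N$, where $\gamma_{N(s)}$ is the geodesic with $\gamma_{N(s)}(0)=\alpha(s)$ and $\gamma_{N(s)}'(0)=N(s)$. At a parameter $(s,\lambda)$ at which $f$ is an immersion, the tangent plane of the surface is the hyperbolic plane $\exp_{f(s,\lambda)}\big(\mathrm{span}\{\partial_sf(s,\lambda),\partial_\lambda f(s,\lambda)\}\big)$. The surface is called developable if, for every $s\in I$, the tangent planes at all parameters $(s,\lambda)$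 at which $f$ is an immersion coincide. The field $N$ is called a rotation minimizing (RM) vector field if it is parallel with respect to the normal connection of $\alpha$, that is, if for every $s\in I$ the component of $\nabla_{\alpha'}N$ orthogonal to $\alpha'$ vanishes. Theorem. The ruled surface $f$ is developable if and only if $N$ is an RM vector field along $\alpha$. Moreover, $N$ is an RM vector field if and only if for every $s\in I$ there is $c\in\mathbb R$ with $(\nabla_{\alpha'}N)(s)=c\,\alpha'(s)$. -/

import Mathlib

open scoped ContDiff

/-- The vector space underlying Minkowski space `ℝ^{1,3}`; the coordinate of index `0` is time.
(The norm of this function space is used only for topology and differentiation.) -/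
abbrev Mink : Type := Fin 4 → ℝ

/-- The Lorentzian inner product `-x₀y₀ + x₁y₁ + x₂y₂ + x₃y₃`. -/
def lor (x y : Mink) : ℝ :=
  -(x 0 * y 0) + x 1 * y 1 + x 2 * y 2 + x 3 * y 3

/-- Hyperbolic 3-space (hyperboloid model): the upper sheet of `⟨x, x⟩ = -1`. Its tangent space
at `p` is `{v | ⟨v, p⟩ = 0}`, and its Riemannian metric is the restriction of `lor`. -/
def H3 : Set Mink := {x | lor x x = -1 ∧ 0 < x 0}

/-- Covariant derivative `∇_{α'} V`, for the Levi-Civita connection of `H3`, of a vector field `V`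
along a curve `α` in `H3`: the orthogonal projection of the derivative `V'(s)` of `V` in the flat
space `Mink` onto the tangent space at `α s`, which is `v ↦ v + ⟨v, p⟩ p` for `p = α s`
(because `⟨p, p⟩ = -1`). -/
noncomputable def covDeriv (α V : ℝ → Mink) (s : ℝ) : Mink :=
  deriv V s + lor (deriv V s) (α s) • α s

/-- `γ : ℝ → H3` is the geodesic with initial point `p` and initial velocity `v`:
`∇_{γ'} γ' = 0`, `γ(0) = p`, `γ'(0) = v`. -/
structure IsGeodesicFrom (γ : ℝ → Mink) (p v : Mink) : Prop where
  smooth : ContDiff ℝ ∞ γ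
  mem : ∀ t, γ t ∈ H3
  covDeriv_eq_zero : ∀ t, covDeriv γ (deriv γ) t = 0
  init : γ 0 = p
  deriv_init : deriv γ 0 = v

/-- `α` is a smooth immersed curve in `H3`, with parameter in `I`. -/
structure IsImmersedCurve (I : Set ℝ) (α : ℝ → Mink) : Prop where
  smooth : ContDiffOn ℝ ∞ α I
  mem : ∀ s ∈ I, α s ∈ H3
  deriv_ne_zero : ∀ s ∈ I, deriv α s ≠ 0

/-- `N` is a smooth unit normal vector field along the curve `α` in `H3`. -/
structure IsUnitNormalField (I : Set ℝ) (α N : ℝ → Mink) : Prop where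
  smooth : ContDiffOn ℝ ∞ N I
  tangent_H3 : ∀ s ∈ I, lor (N s) (α s) = 0
  unit : ∀ s ∈ I, lor (N s) (N s) = 1
  normal : ∀ s ∈ I, lor (N s) (deriv α s) = 0

/-- Covariant derivative of `N` along `α` for the normal connection of `α`: the component of
`∇_{α'} N` orthogonal to `α'`. -/
noncomputable def normalCovDeriv (α N : ℝ → Mink) (s : ℝ) : Mink :=
  covDeriv α N s -
    (lor (covDeriv α N s) (deriv α s) / lor (deriv α s) (deriv α s)) • deriv α s

/-- A normal vector field is rotation minimizing (RM) if it is parallel for the normal connection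
of the curve. -/
def IsRM (I : Set ℝ) (α N : ℝ → Mink) : Prop :=
  ∀ s ∈ I, normalCovDeriv α N s = 0

/-- `f(s, t) = γ_{N(s)}(t)`: for each `s`, the curve `f(s, ·)` is the geodesic of `H3` through
`α s` with initial velocity `N s`. -/
def IsRuledSurface (I : Set ℝ) (α N : ℝ → Mink) (f : ℝ → ℝ → Mink) : Prop :=
  ∀ s ∈ I, IsGeodesicFrom (f s) (α s) (N s)

/-- The parametrized surface `f` is an immersion at the parameter `(s, t)`. -/
def IsRegularPoint (f : ℝ → ℝ → Mink) (s t : ℝ) : Prop :=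
  LinearIndependent ℝ ![deriv (fun u => f u t) s, deriv (f s) t]

/-- The tangent vector plane of the surface `f` at the parameter `(s, t)`. -/
noncomputable def tangentVectorPlane (f : ℝ → ℝ → Mink) (s t : ℝ) : Submodule ℝ Mink :=
  Submodule.span ℝ {deriv (fun u => f u t) s, deriv (f s) t}

/-- The tangent plane of the surface `f` at the parameter `(s, t)`: the hyperbolic plane
`exp_p (T_p S)`, `p = f(s, t)`, where `exp_p v = γ(1)` for the geodesic `γ` with initial point `p`
and initial velocity `v`. -/
def tangentPlane (f : ℝ → ℝ → Mink) (s t : ℝ) : Set Mink :=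
  {q | ∃ v ∈ tangentVectorPlane f s t, ∃ γ : ℝ → Mink, IsGeodesicFrom γ (f s t) v ∧ γ 1 = q}

/-- The ruled surface `f` is developable: along each ruling the tangent plane is the same at all
points (at which the surface is immersed, so that it has a tangent plane). -/
def IsDevelopable (I : Set ℝ) (f : ℝ → ℝ → Mink) : Prop :=
  ∀ s ∈ I, ∀ t₁ t₂ : ℝ, IsRegularPoint f s t₁ → IsRegularPoint f s t₂ →
    tangentPlane f s t₁ = tangentPlane f s t₂

/-!
A geodesic of `H3` satisfies `γ'' = c² γ`, where `c` is its constant speed, so it is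
`cosh (c t) p + (sinh (c t) / c) v` (`IsGeodesicFrom.eq_cosh_add_sinh`). Hence the exponential map
at `p` sends a linear space `T` of tangent vectors onto the intersection of `H3` with the linear
span of `p` and `T` (`exp_image_eq`), and the ruled surface is
`f(s, t) = cosh t α(s) + sinh t N(s)`.

Differentiating the orthogonality relations shows that `α'` and `N'` are both orthogonal to `α` and
to `N`; in particular `∇_{α'} N = N'`. As `f` and `∂ₜf` span the same plane as `α` and `N`, the
tangent plane at `(s, t)` is the intersection of `H3` with the span of `α`, `N` and
`cosh t α' + sinh t N'` (`mem_tangentPlane_iff`). If `N' = c α'`, this is the span of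
`α`, `N`, `α'` at every regular point. Conversely, let the surface be developable and put
`X = cosh 1 α' + sinh 1 N'`. If `X = 0`, then `N'` is a multiple of `α'`. Otherwise `t = 0` and
`t = 1` are both regular, and equality of the two tangent planes puts `X` in the span of `α`, `N`,
`α'`; as `X` is orthogonal to `α` and `N`, it is a multiple of `α'`, and so is `N'`
(`IsDevelopable.exists_deriv_eq_smul`).
-/

/-! ### The Lorentzian inner product -/

lemma lor_comm (x y : Mink) : lor x y = lor y x := by
  simp only [lor]; ring

lemma lor_add_left (x y z : Mink) : lor (x + y) z = lor x z + lor y z := by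
  simp only [lor, Pi.add_apply]; ring

lemma lor_smul_left (a : ℝ) (x z : Mink) : lor (a • x) z = a * lor x z := by
  simp only [lor, Pi.smul_apply, smul_eq_mul]; ring

lemma lor_add_right (x y z : Mink) : lor z (x + y) = lor z x + lor z y := by
  simp only [lor, Pi.add_apply]; ring

lemma lor_smul_right (a : ℝ) (x z : Mink) : lor z (a • x) = a * lor z x := by
  simp only [lor, Pi.smul_apply, smul_eq_mul]; ring

lemma lor_zero_left (z : Mink) : lor 0 z = 0 := by
  simp [lor]

lemma HasDerivAt.lor {u v : ℝ → Mink} {u' v' : Mink} {s : ℝ}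
    (hu : HasDerivAt u u' s) (hv : HasDerivAt v v' s) :
    HasDerivAt (fun t => lor (u t) (v t)) (lor u' (v s) + lor (u s) v') s := by
  have hu := hasDerivAt_pi.1 hu
  have hv := hasDerivAt_pi.1 hv
  have h := ((((hu 0).mul (hv 0)).neg.add ((hu 1).mul (hv 1))).add ((hu 2).mul (hv 2))).add
    ((hu 3).mul (hv 3))
  refine h.congr_deriv ?_
  simp only [_root_.lor]; ring

/-! ### Tangent vectors of hyperbolic space -/

/-- The Cauchy–Schwarz inequality for the spatial parts of `v` and `p`, after substituting
`⟨v, p⟩ = 0` and `⟨p, p⟩ = -1`. -/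
lemma spatial_sq_le_of_tangent {p v : Mink} (hp : p ∈ H3) (h : lor v p = 0) :
    v 1 ^ 2 + v 2 ^ 2 + v 3 ^ 2 ≤ p 0 ^ 2 * lor v v := by
  have h1 : lor p p = -1 := hp.1
  simp only [lor] at *
  have e0 : v 0 * p 0 = v 1 * p 1 + v 2 * p 2 + v 3 * p 3 := by linarith
  have e1 : p 0 ^ 2 = 1 + p 1 ^ 2 + p 2 ^ 2 + p 3 ^ 2 := by linarith
  have e2 : p 0 ^ 2 * v 0 ^ 2 = (v 1 * p 1 + v 2 * p 2 + v 3 * p 3) ^ 2 := by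
    rw [← e0]; ring
  have e3 : p 0 ^ 2 * (-(v 0 * v 0) + v 1 * v 1 + v 2 * v 2 + v 3 * v 3)
      = p 0 ^ 2 * (v 1 ^ 2 + v 2 ^ 2 + v 3 ^ 2) - p 0 ^ 2 * v 0 ^ 2 := by ring
  rw [e3, e2, e1]
  nlinarith [sq_nonneg (v 1 * p 2 - v 2 * p 1), sq_nonneg (v 1 * p 3 - v 3 * p 1),
    sq_nonneg (v 2 * p 3 - v 3 * p 2)]

lemma lor_self_pos {p v : Mink} (hp : p ∈ H3) (h : lor v p = 0) (hv : v ≠ 0) :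
    0 < lor v v := by
  have h1 := spatial_sq_le_of_tangent hp h
  have hp0 : 0 < p 0 := hp.2
  by_contra! hle
  have h2 : v 1 ^ 2 + v 2 ^ 2 + v 3 ^ 2 ≤ 0 :=
    h1.trans (mul_nonpos_of_nonneg_of_nonpos (sq_nonneg _) hle)
  have v1 : v 1 = 0 := by nlinarith [sq_nonneg (v 1), sq_nonneg (v 2), sq_nonneg (v 3)]
  have v2 : v 2 = 0 := by nlinarith [sq_nonneg (v 1), sq_nonneg (v 2), sq_nonneg (v 3)]
  have v3 : v 3 = 0 := by nlinarith [sq_nonneg (v 1), sq_nonneg (v 2), sq_nonneg (v 3)]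
  have v0 : v 0 = 0 := by
    simp only [lor, v1, v2, v3] at h
    have : v 0 * p 0 = 0 := by linarith
    exact (mul_eq_zero.1 this).resolve_right hp0.ne'
  exact hv (by ext i; fin_cases i <;> assumption)

lemma abs_time_lt_of_unit_tangent {p e : Mink} (hp : p ∈ H3) (h : lor e p = 0)
    (he : lor e e = 1) : |e 0| < p 0 := by
  have h1 := spatial_sq_le_of_tangent hp h
  rw [he] at h1
  simp only [lor] at he
  exact abs_lt_of_sq_lt_sq (by nlinarith) hp.2.le

/-- Points of the upper sheet have negative Lorentzian product (reversed Cauchy–Schwarz). -/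
lemma lor_neg_of_mem {p q : Mink} (hp : p ∈ H3) (hq : q ∈ H3) : lor q p < 0 := by
  obtain ⟨hp1, hp0⟩ := hp
  obtain ⟨hq1, hq0⟩ := hq
  simp only [lor] at *
  have : q 1 * p 1 + q 2 * p 2 + q 3 * p 3 < q 0 * p 0 := by
    refine lt_of_pow_lt_pow_left₀ 2 (by positivity) ?_
    have e1 : p 0 ^ 2 = 1 + p 1 ^ 2 + p 2 ^ 2 + p 3 ^ 2 := by linarith
    have e2 : q 0 ^ 2 = 1 + q 1 ^ 2 + q 2 ^ 2 + q 3 ^ 2 := by linarith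
    rw [mul_pow, e1, e2]
    nlinarith [sq_nonneg (q 1 * p 2 - q 2 * p 1), sq_nonneg (q 1 * p 3 - q 3 * p 1),
      sq_nonneg (q 2 * p 3 - q 3 * p 2), sq_nonneg (p 1), sq_nonneg (p 2), sq_nonneg (p 3),
      sq_nonneg (q 1), sq_nonneg (q 2), sq_nonneg (q 3)]
  linarith

lemma lor_deriv_self_of_mem {I : Set ℝ} (hI : IsOpen I) {α : ℝ → Mink}
    (hα : ∀ s ∈ I, α s ∈ H3) {s : ℝ} (hs : s ∈ I) (hd : DifferentiableAt ℝ α s) :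
    lor (deriv α s) (α s) = 0 := by
  have h1 := hd.hasDerivAt.lor hd.hasDerivAt
  have h2 : (fun t => lor (α t) (α t)) =ᶠ[nhds s] fun _ => -1 := by
    filter_upwards [hI.mem_nhds hs] with t ht using (hα t ht).1
  have h3 := (h1.congr_of_eventuallyEq h2.symm).unique (hasDerivAt_const s (-1 : ℝ))
  rw [lor_comm (α s)] at h3
  linarith

/-! ### Geodesics -/

lemma hasDerivAt_cosh_mul (c t : ℝ) :
    HasDerivAt (fun t => Real.cosh (c * t)) (c * Real.sinh (c * t)) t := by
  have h := ((hasDerivAt_id t).const_mul c).cosh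
  refine h.congr_deriv ?_
  simp only [id]; ring

lemma hasDerivAt_sinh_mul (c t : ℝ) :
    HasDerivAt (fun t => Real.sinh (c * t)) (c * Real.cosh (c * t)) t := by
  have h := ((hasDerivAt_id t).const_mul c).sinh
  refine h.congr_deriv ?_
  simp only [id]; ring

/-- Uniqueness of geodesics, with the explicit solution. For `v = 0` the division by `0` gives the
correct value, since the geodesic is then constant. -/
lemma IsGeodesicFrom.eq_cosh_add_sinh {γ : ℝ → Mink} {p v : Mink} (h : IsGeodesicFrom γ p v)
    (t : ℝ) :
    γ t = Real.cosh (√(lor v v) * t) • p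
      + (Real.sinh (√(lor v v) * t) / √(lor v v)) • v := by
  have hd : ∀ t, HasDerivAt γ (deriv γ t) t := fun t =>
    (h.smooth.differentiable (by simp) t).hasDerivAt
  have hdd : ∀ t, HasDerivAt (deriv γ) (deriv (deriv γ) t) t := fun t =>
    (((contDiff_infty_iff_deriv.1 h.smooth).2).differentiable (by simp) t).hasDerivAt
  have hort : ∀ t, lor (deriv γ t) (γ t) = 0 := fun t =>
    lor_deriv_self_of_mem isOpen_univ (fun s _ => h.mem s) (Set.mem_univ t) (hd t).differentiableAt
  have hpv : lor v p = 0 := by rw [← h.init, ← h.deriv_init]; exact hort 0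
  have hacc : ∀ t, lor (deriv (deriv γ) t) (γ t) = - lor (deriv γ t) (deriv γ t) := by
    intro t
    have h1 := (hdd t).lor (hd t)
    simp only [hort] at h1
    linarith [h1.unique (hasDerivAt_const t (0 : ℝ))]
  -- by `hacc` the geodesic equation reads `γ'' = ⟨γ', γ'⟩ γ`
  have heq : ∀ t, deriv (deriv γ) t = lor (deriv γ t) (deriv γ t) • γ t := by
    intro t
    have h1 := h.covDeriv_eq_zero t
    rw [covDeriv, hacc, neg_smul, ← sub_eq_add_neg, sub_eq_zero] at h1
    exact h1
  have hspeed : ∀ t, lor (deriv γ t) (deriv γ t) = lor v v := by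
    intro t
    rw [← h.deriv_init]
    refine is_const_of_deriv_eq_zero (f := fun t => lor (deriv γ t) (deriv γ t))
      (fun t => ((hdd t).lor (hdd t)).differentiableAt) (fun t => ?_) t 0
    rw [((hdd t).lor (hdd t)).deriv, heq, lor_smul_left, lor_smul_right, lor_comm (γ t), hort]
    ring
  by_cases hv : v = 0
  · -- zero speed forces zero velocity
    have hz : ∀ t, deriv γ t = 0 := by
      intro t
      by_contra hne
      have := lor_self_pos (h.mem t) (hort t) hne
      rw [hspeed, hv, lor_zero_left] at this
      exact lt_irrefl _ this
    have := is_const_of_deriv_eq_zero (fun t => (hd t).differentiableAt) hz t 0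
    simp [this, h.init, hv, lor_zero_left]
  · have hpos : 0 < lor v v := lor_self_pos (h.init ▸ h.mem 0) hpv hv
    have hc : 0 < √(lor v v) := Real.sqrt_pos.2 hpos
    have hc2 : √(lor v v) * √(lor v v) = lor v v := Real.mul_self_sqrt hpos.le
    set c := √(lor v v)
    -- the left-hand sides of `hA` and `hB` are first integrals of the linear equation `γ'' = c² γ`
    have hA : Real.cosh (c * t) • γ t - (Real.sinh (c * t) / c) • deriv γ t = p := by
      have hA' : ∀ t, HasDerivAt
          (fun t => Real.cosh (c * t) • γ t - (Real.sinh (c * t) / c) • deriv γ t) 0 t := by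
        intro t
        refine (((hasDerivAt_cosh_mul c t).smul (hd t)).sub
          (((hasDerivAt_sinh_mul c t).div_const c).smul (hdd t))).congr_deriv ?_
        rw [heq, hspeed, ← hc2]
        ext i
        simp only [Pi.sub_apply, Pi.add_apply, Pi.smul_apply, smul_eq_mul, Pi.zero_apply]
        field_simp
        ring
      have := is_const_of_deriv_eq_zero (fun t => (hA' t).differentiableAt)
        (fun t => (hA' t).deriv) t 0
      simpa [h.init] using this
    have hB : Real.cosh (c * t) • deriv γ t - (c * Real.sinh (c * t)) • γ t = v := by
      have hB' : ∀ t, HasDerivAt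
          (fun t => Real.cosh (c * t) • deriv γ t - (c * Real.sinh (c * t)) • γ t) 0 t := by
        intro t
        refine (((hasDerivAt_cosh_mul c t).smul (hdd t)).sub
          (((hasDerivAt_sinh_mul c t).const_mul c).smul (hd t))).congr_deriv ?_
        rw [heq, hspeed, ← hc2]
        ext i
        simp only [Pi.sub_apply, Pi.add_apply, Pi.smul_apply, smul_eq_mul, Pi.zero_apply]
        ring
      have := is_const_of_deriv_eq_zero (fun t => (hB' t).differentiableAt)
        (fun t => (hB' t).deriv) t 0
      simpa [h.deriv_init] using this
    conv_rhs => rw [← hA, ← hB]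
    have hcs := Real.cosh_sq (c * t)
    ext i
    simp only [Pi.sub_apply, Pi.add_apply, Pi.smul_apply, smul_eq_mul]
    field_simp
    linear_combination (-(c * γ t i)) * hcs

lemma IsGeodesicFrom.const {p : Mink} (hp : p ∈ H3) : IsGeodesicFrom (fun _ => p) p 0 where
  smooth := contDiff_const
  mem _ := hp
  covDeriv_eq_zero t := by
    have h : deriv (fun _ : ℝ => p) = fun _ => 0 := by ext1 t; simp
    simp [covDeriv, h, lor_zero_left]
  init := rfl
  deriv_init := by simp

lemma hasDerivAt_cosh_add_sinh (p e : Mink) (c t : ℝ) :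
    HasDerivAt (fun t => Real.cosh (c * t) • p + Real.sinh (c * t) • e)
      ((c * Real.sinh (c * t)) • p + (c * Real.cosh (c * t)) • e) t :=
  ((hasDerivAt_cosh_mul c t).smul_const p).add ((hasDerivAt_sinh_mul c t).smul_const e)

lemma isGeodesicFrom_cosh_add_sinh {p e : Mink} (hp : p ∈ H3) (hep : lor e p = 0)
    (he : lor e e = 1) (c : ℝ) :
    IsGeodesicFrom (fun t => Real.cosh (c * t) • p + Real.sinh (c * t) • e) p (c • e) := by
  have hpe : lor p e = 0 := by rw [lor_comm, hep]
  have hpp : lor p p = -1 := hp.1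
  have hd : deriv (fun t => Real.cosh (c * t) • p + Real.sinh (c * t) • e)
      = fun t => (c * Real.sinh (c * t)) • p + (c * Real.cosh (c * t)) • e := by
    ext1 t; exact (hasDerivAt_cosh_add_sinh p e c t).deriv
  refine ⟨?_, fun t => ⟨?_, ?_⟩, fun t => ?_, by simp, by rw [hd]; simp⟩
  · have h1 : ContDiff ℝ ∞ fun t : ℝ => c * t := contDiff_const.mul contDiff_id
    exact ((Real.contDiff_cosh.comp h1).smul contDiff_const).add
      ((Real.contDiff_sinh.comp h1).smul contDiff_const)
  · simp only [lor_add_left, lor_add_right, lor_smul_left, lor_smul_right, hep, hpe, he, hpp]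
    linear_combination -Real.cosh_sq (c * t)
  · have h1 := abs_time_lt_of_unit_tangent hp hep he
    have h2 : |Real.sinh (c * t)| < Real.cosh (c * t) :=
      abs_lt_of_sq_lt_sq (by linarith [Real.cosh_sq (c * t)]) (Real.cosh_pos _).le
    have h3 : |Real.sinh (c * t)| * |e 0| < Real.cosh (c * t) * p 0 :=
      mul_lt_mul'' h2 h1 (abs_nonneg _) (abs_nonneg _)
    rw [← abs_mul] at h3
    simp only [Pi.add_apply, Pi.smul_apply, smul_eq_mul]
    linarith [neg_abs_le (Real.sinh (c * t) * e 0)]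
  · have hdd : deriv (deriv fun t => Real.cosh (c * t) • p + Real.sinh (c * t) • e) t
        = (c ^ 2) • (Real.cosh (c * t) • p + Real.sinh (c * t) • e) := by
      rw [hd]
      have := (((hasDerivAt_sinh_mul c t).const_mul c).smul_const p).add
        (((hasDerivAt_cosh_mul c t).const_mul c).smul_const e)
      refine (this.congr_deriv ?_).deriv
      simp only [smul_add, smul_smul]
      ring_nf
    rw [covDeriv, hdd]
    have hm : lor (Real.cosh (c * t) • p + Real.sinh (c * t) • e)
        (Real.cosh (c * t) • p + Real.sinh (c * t) • e) = -1 := by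
      simp only [lor_add_left, lor_add_right, lor_smul_left, lor_smul_right, hep, hpe, he, hpp]
      linear_combination -Real.cosh_sq (c * t)
    rw [lor_smul_left, hm]
    module

/-- The exponential map at `p` carries a linear space `T` of tangent vectors onto the intersection
of `H3` with the linear span of `p` and `T`. -/
lemma exp_image_eq {p : Mink} (hp : p ∈ H3) {T : Submodule ℝ Mink}
    (hT : ∀ v ∈ T, lor v p = 0) (q : Mink) :
    (∃ v ∈ T, ∃ γ : ℝ → Mink, IsGeodesicFrom γ p v ∧ γ 1 = q) ↔
      q ∈ H3 ∧ ∃ a : ℝ, ∃ w ∈ T, q = a • p + w := by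
  constructor
  · rintro ⟨v, hv, γ, hγ, rfl⟩
    exact ⟨hγ.mem 1, _, _, T.smul_mem _ hv, hγ.eq_cosh_add_sinh 1⟩
  · rintro ⟨hq, a, w, hw, rfl⟩
    have hwp := hT w hw
    have hpw : lor p w = 0 := by rw [lor_comm, hwp]
    have hpp : lor p p = -1 := hp.1
    have ha : 0 < a := by
      have := lor_neg_of_mem hp hq
      rw [lor_add_left, lor_smul_left, hpp, hwp] at this
      linarith
    have ha2 : a ^ 2 = 1 + lor w w := by
      have : lor (a • p + w) (a • p + w) = -1 := hq.1
      simp only [lor_add_left, lor_add_right, lor_smul_left, lor_smul_right, hwp, hpw, hpp] at this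
      linarith
    by_cases hw0 : w = 0
    · rw [hw0, lor_zero_left, add_zero] at ha2
      have ha1 : a = 1 := by nlinarith
      exact ⟨0, T.zero_mem, _, IsGeodesicFrom.const hp, by simp [ha1, hw0]⟩
    · have hww := lor_self_pos hp hwp hw0
      have hr : 0 < √(lor w w) := Real.sqrt_pos.2 hww
      have hr2 : √(lor w w) ^ 2 = lor w w := Real.sq_sqrt hww.le
      set r := √(lor w w)
      have he : lor (r⁻¹ • w) (r⁻¹ • w) = 1 := by
        rw [lor_smul_left, lor_smul_right, ← hr2]; field_simp
      have hep : lor (r⁻¹ • w) p = 0 := by rw [lor_smul_left, hwp, mul_zero]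
      -- the distance from `p` to `a p + w` is `arsinh r`
      refine ⟨_, T.smul_mem _ (T.smul_mem _ hw), _,
        isGeodesicFrom_cosh_add_sinh hp hep he (Real.arsinh r), ?_⟩
      have hcosh : Real.cosh (Real.arsinh r) = a := by
        rw [Real.cosh_arsinh, hr2, ← ha2, Real.sqrt_sq ha.le]
      simp only [mul_one, hcosh, Real.sinh_arsinh, smul_smul, mul_inv_cancel₀ hr.ne', one_smul]

/-! ### Ruled surfaces -/

section RuledSurface

variable {I : Set ℝ} {α N : ℝ → Mink} {f : ℝ → ℝ → Mink} {s : ℝ}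

lemma IsImmersedCurve.hasDerivAt (hα : IsImmersedCurve I α) (hI : IsOpen I) (hs : s ∈ I) :
    HasDerivAt α (deriv α s) s :=
  ((hα.smooth.contDiffAt (hI.mem_nhds hs)).differentiableAt (by simp)).hasDerivAt

lemma IsUnitNormalField.hasDerivAt (hN : IsUnitNormalField I α N) (hI : IsOpen I) (hs : s ∈ I) :
    HasDerivAt N (deriv N s) s :=
  ((hN.smooth.contDiffAt (hI.mem_nhds hs)).differentiableAt (by simp)).hasDerivAt

lemma IsImmersedCurve.lor_deriv_self (hα : IsImmersedCurve I α) (hI : IsOpen I) (hs : s ∈ I) :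
    lor (deriv α s) (α s) = 0 :=
  lor_deriv_self_of_mem hI hα.mem hs (hα.hasDerivAt hI hs).differentiableAt

lemma IsImmersedCurve.lor_deriv_pos (hα : IsImmersedCurve I α) (hI : IsOpen I) (hs : s ∈ I) :
    0 < lor (deriv α s) (deriv α s) :=
  lor_self_pos (hα.mem s hs) (hα.lor_deriv_self hI hs) (hα.deriv_ne_zero s hs)

lemma IsUnitNormalField.lor_deriv_self (hN : IsUnitNormalField I α N) (hI : IsOpen I)
    (hs : s ∈ I) : lor (deriv N s) (N s) = 0 := by
  have hd := hN.hasDerivAt hI hs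
  have h2 : (fun t => lor (N t) (N t)) =ᶠ[nhds s] fun _ => 1 := by
    filter_upwards [hI.mem_nhds hs] with t ht using hN.unit t ht
  have h3 := ((hd.lor hd).congr_of_eventuallyEq h2.symm).unique (hasDerivAt_const s (1 : ℝ))
  rw [lor_comm (N s)] at h3
  linarith

lemma IsUnitNormalField.lor_deriv_curve (hN : IsUnitNormalField I α N)
    (hα : IsImmersedCurve I α) (hI : IsOpen I) (hs : s ∈ I) : lor (deriv N s) (α s) = 0 := by
  have h2 : (fun t => lor (N t) (α t)) =ᶠ[nhds s] fun _ => 0 := by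
    filter_upwards [hI.mem_nhds hs] with t ht using hN.tangent_H3 t ht
  have h3 := (((hN.hasDerivAt hI hs).lor (hα.hasDerivAt hI hs)).congr_of_eventuallyEq
    h2.symm).unique (hasDerivAt_const s (0 : ℝ))
  rwa [hN.normal s hs, add_zero] at h3

lemma covDeriv_eq_deriv (hI : IsOpen I) (hα : IsImmersedCurve I α)
    (hN : IsUnitNormalField I α N) (hs : s ∈ I) : covDeriv α N s = deriv N s := by
  rw [covDeriv, hN.lor_deriv_curve hα hI hs, zero_smul, add_zero]

lemma IsRuledSurface.eq (hf : IsRuledSurface I α N f) (hN : IsUnitNormalField I α N)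
    (hs : s ∈ I) (t : ℝ) : f s t = Real.cosh t • α s + Real.sinh t • N s := by
  simpa [hN.unit s hs] using (hf s hs).eq_cosh_add_sinh t

lemma IsRuledSurface.deriv_ruling (hf : IsRuledSurface I α N f) (hN : IsUnitNormalField I α N)
    (hs : s ∈ I) (t : ℝ) : deriv (f s) t = Real.sinh t • α s + Real.cosh t • N s := by
  rw [funext (hf.eq hN hs)]
  simpa using (hasDerivAt_cosh_add_sinh (α s) (N s) 1 t).deriv

lemma IsRuledSurface.deriv_base (hf : IsRuledSurface I α N f) (hI : IsOpen I)
    (hα : IsImmersedCurve I α) (hN : IsUnitNormalField I α N) (hs : s ∈ I) (t : ℝ) :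
    deriv (fun u => f u t) s = Real.cosh t • deriv α s + Real.sinh t • deriv N s := by
  have h1 : (fun u => f u t) =ᶠ[nhds s] fun u => Real.cosh t • α u + Real.sinh t • N u := by
    filter_upwards [hI.mem_nhds hs] with u hu using hf.eq hN hu t
  rw [h1.deriv_eq]
  exact (((hα.hasDerivAt hI hs).const_smul (Real.cosh t)).add
    ((hN.hasDerivAt hI hs).const_smul (Real.sinh t))).deriv

/-- A tangent plane of the ruled surface is a linear section of `H3` which contains the ruling. -/
lemma mem_tangentPlane_iff (hf : IsRuledSurface I α N f) (hI : IsOpen I)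
    (hα : IsImmersedCurve I α) (hN : IsUnitNormalField I α N) (hs : s ∈ I) (t : ℝ) (q : Mink) :
    q ∈ tangentPlane f s t ↔ q ∈ H3 ∧ ∃ a b d : ℝ, q = a • α s + b • N s
      + d • (Real.cosh t • deriv α s + Real.sinh t • deriv N s) := by
  have hp : f s t ∈ H3 := (hf s hs).mem t
  have hT : ∀ v ∈ tangentVectorPlane f s t, lor v (f s t) = 0 := by
    intro v hv
    obtain ⟨a, b, rfl⟩ := Submodule.mem_span_pair.1 hv
    have h1 := hN.lor_deriv_self hI hs
    have h2 := hN.lor_deriv_curve hα hI hs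
    have h3 := hα.lor_deriv_self hI hs
    have h4 := hN.normal s hs
    have h5 := hN.tangent_H3 s hs
    have h6 : lor (α s) (α s) = -1 := (hα.mem s hs).1
    rw [lor_comm] at h4
    have h7 : lor (α s) (N s) = 0 := by rw [lor_comm, h5]
    rw [hf.deriv_ruling hN hs, hf.deriv_base hI hα hN hs, hf.eq hN hs]
    simp only [lor_add_left, lor_add_right, lor_smul_left, lor_smul_right, h1, h2, h3, h4, h5, h6,
      h7, hN.unit s hs]
    ring
  rw [tangentPlane, Set.mem_ofPred_eq, exp_image_eq hp hT, and_congr_right_iff]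
  intro _
  have hcs := Real.cosh_sq t
  constructor
  · rintro ⟨a, w, hw, rfl⟩
    obtain ⟨d, b, rfl⟩ := Submodule.mem_span_pair.1 hw
    rw [hf.deriv_ruling hN hs, hf.deriv_base hI hα hN hs, hf.eq hN hs]
    exact ⟨a * Real.cosh t + b * Real.sinh t, a * Real.sinh t + b * Real.cosh t, d, by module⟩
  · rintro ⟨a, b, d, rfl⟩
    -- the hyperbolic rotation by `t` is inverted by the one by `-t`
    refine ⟨a * Real.cosh t - b * Real.sinh t, _, Submodule.mem_span_pair.2
      ⟨d, b * Real.cosh t - a * Real.sinh t, rfl⟩, ?_⟩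
    rw [hf.deriv_ruling hN hs, hf.deriv_base hI hα hN hs, hf.eq hN hs]
    ext i
    simp only [Pi.add_apply, Pi.smul_apply, smul_eq_mul]
    linear_combination (-(a * α s i) - b * N s i) * hcs

/-- At a point where `∂ₛf ≠ 0` the ruled surface is an immersion, since `∂ₛf` is orthogonal to the
unit vector `∂ₜf`. -/
lemma isRegularPoint_of_ne_zero (hf : IsRuledSurface I α N f) (hI : IsOpen I)
    (hα : IsImmersedCurve I α) (hN : IsUnitNormalField I α N) (hs : s ∈ I) {t : ℝ}
    (hne : Real.cosh t • deriv α s + Real.sinh t • deriv N s ≠ 0) : IsRegularPoint f s t := by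
  have h1 := hN.lor_deriv_self hI hs
  have h2 := hN.lor_deriv_curve hα hI hs
  have h3 := hα.lor_deriv_self hI hs
  have h4 := hN.normal s hs
  have h5 := hN.tangent_H3 s hs
  have h6 : lor (α s) (α s) = -1 := (hα.mem s hs).1
  rw [lor_comm] at h4
  have h7 : lor (α s) (N s) = 0 := by rw [lor_comm, h5]
  rw [IsRegularPoint, hf.deriv_ruling hN hs, hf.deriv_base hI hα hN hs, LinearIndependent.pair_iff]
  intro a b hab
  have hb : b = 0 := by
    have h8 := congrArg (fun x => lor x (Real.sinh t • α s + Real.cosh t • N s)) hab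
    simp only [lor_add_left, lor_add_right, lor_smul_left, lor_smul_right, h1, h2, h3, h4, h5, h6,
      h7, hN.unit s hs, lor_zero_left] at h8
    linear_combination h8 - b * Real.cosh_sq t
  rw [hb, zero_smul, add_zero] at hab
  exact ⟨(smul_eq_zero.1 hab).resolve_right hne, hb⟩

lemma isRM_iff_exists_smul (hI : IsOpen I) (hα : IsImmersedCurve I α) :
    IsRM I α N ↔ ∀ s ∈ I, ∃ c : ℝ, covDeriv α N s = c • deriv α s := by
  refine forall₂_congr fun s hs => ⟨fun h => ⟨_, sub_eq_zero.1 h⟩, ?_⟩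
  rintro ⟨c, hc⟩
  rw [normalCovDeriv, hc, lor_smul_left, mul_div_cancel_right₀ _ (hα.lor_deriv_pos hI hs).ne',
    sub_self]

lemma isDevelopable_of_deriv_eq_smul (hf : IsRuledSurface I α N f) (hI : IsOpen I)
    (hα : IsImmersedCurve I α) (hN : IsUnitNormalField I α N)
    (h : ∀ s ∈ I, ∃ c : ℝ, deriv N s = c • deriv α s) : IsDevelopable I f := by
  intro s hs
  obtain ⟨c, hc⟩ := h s hs
  have key : ∀ t, IsRegularPoint f s t → ∀ q, q ∈ tangentPlane f s t ↔
      q ∈ H3 ∧ ∃ a b d : ℝ, q = a • α s + b • N s + d • deriv α s := by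
    intro t ht q
    have hX : Real.cosh t • deriv α s + Real.sinh t • deriv N s
        = (Real.cosh t + Real.sinh t * c) • deriv α s := by rw [hc]; module
    have hne : Real.cosh t + Real.sinh t * c ≠ 0 := by
      intro h0
      refine ht.ne_zero 0 ?_
      simp [hf.deriv_base hI hα hN hs, hX, h0]
    rw [mem_tangentPlane_iff hf hI hα hN hs, hX, and_congr_right_iff]
    intro _
    constructor
    · rintro ⟨a, b, d, rfl⟩
      exact ⟨a, b, d * (Real.cosh t + Real.sinh t * c), by rw [smul_smul]⟩
    · rintro ⟨a, b, d, rfl⟩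
      exact ⟨a, b, d / (Real.cosh t + Real.sinh t * c), by rw [smul_smul, div_mul_cancel₀ _ hne]⟩
  intro t₁ t₂ h₁ h₂
  ext q
  rw [key t₁ h₁, key t₂ h₂]

lemma IsDevelopable.exists_deriv_eq_smul (hdev : IsDevelopable I f)
    (hf : IsRuledSurface I α N f) (hI : IsOpen I) (hα : IsImmersedCurve I α)
    (hN : IsUnitNormalField I α N) (hs : s ∈ I) : ∃ c : ℝ, deriv N s = c • deriv α s := by
  have hsinh : Real.sinh 1 ≠ 0 := (Real.sinh_pos_iff.2 one_pos).ne'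
  -- it is enough that `∂ₛf(s, 1)` is a multiple of `α'`
  suffices h : ∃ d : ℝ, Real.cosh 1 • deriv α s + Real.sinh 1 • deriv N s = d • deriv α s by
    obtain ⟨d, hd⟩ := h
    refine ⟨(Real.sinh 1)⁻¹ * (d - Real.cosh 1), ?_⟩
    rw [mul_smul, sub_smul, ← hd, add_sub_cancel_left, inv_smul_smul₀ hsinh]
  by_cases hX : Real.cosh 1 • deriv α s + Real.sinh 1 • deriv N s = 0
  · exact ⟨0, by rw [hX, zero_smul]⟩
  have hr1 : IsRegularPoint f s 1 := isRegularPoint_of_ne_zero hf hI hα hN hs hX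
  have hr0 : IsRegularPoint f s 0 := isRegularPoint_of_ne_zero hf hI hα hN hs
    (by simpa using hα.deriv_ne_zero s hs)
  have h1 := hN.lor_deriv_self hI hs
  have h2 := hN.lor_deriv_curve hα hI hs
  have h3 := hα.lor_deriv_self hI hs
  have h4 : lor (deriv α s) (N s) = 0 := by rw [lor_comm, hN.normal s hs]
  have h5 := hN.tangent_H3 s hs
  have h6 : lor (α s) (α s) = -1 := (hα.mem s hs).1
  have h7 : lor (α s) (N s) = 0 := by rw [lor_comm, h5]
  set X := Real.cosh 1 • deriv α s + Real.sinh 1 • deriv N s with hXdef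
  have hXα : lor X (α s) = 0 := by
    rw [hXdef, lor_add_left, lor_smul_left, lor_smul_left, h2, h3]; ring
  have hXN : lor X (N s) = 0 := by
    rw [hXdef, lor_add_left, lor_smul_left, lor_smul_left, h1, h4]; ring
  have hXX := lor_self_pos (hα.mem s hs) hXα hX
  -- the point `q = √(1 + ⟨X, X⟩) α + X` of `H3` lies in the tangent plane at `t = 1`
  have hsq : √(1 + lor X X) ^ 2 = 1 + lor X X := Real.sq_sqrt (by linarith)
  have hq : √(1 + lor X X) • α s + X ∈ H3 := by
    have hαX : lor (α s) X = 0 := by rw [lor_comm, hXα]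
    have h0 : 0 < α s 0 := (hα.mem s hs).2
    refine ⟨?_, ?_⟩
    · simp only [lor_add_left, lor_add_right, lor_smul_left, lor_smul_right, hXα, hαX, h6]
      linarith
    · have h8 := spatial_sq_le_of_tangent (hα.mem s hs) hXα
      have h9 : |X 0| < √(1 + lor X X) * α s 0 := by
        refine abs_lt_of_sq_lt_sq ?_ (by positivity)
        rw [mul_pow, hsq]
        have h10 : X 0 ^ 2 = X 1 ^ 2 + X 2 ^ 2 + X 3 ^ 2 - lor X X := by simp only [lor]; ring
        nlinarith
      simp only [Pi.add_apply, Pi.smul_apply, smul_eq_mul]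
      linarith [neg_abs_le (X 0)]
  have hq1 : √(1 + lor X X) • α s + X ∈ tangentPlane f s 1 :=
    (mem_tangentPlane_iff hf hI hα hN hs 1 _).2 ⟨hq, √(1 + lor X X), 0, 1, by module⟩
  rw [← hdev s hs 0 1 hr0 hr1, mem_tangentPlane_iff hf hI hα hN hs] at hq1
  obtain ⟨-, a, b, d, hab⟩ := hq1
  simp only [Real.cosh_zero, Real.sinh_zero, one_smul, zero_smul, add_zero] at hab
  have ha : √(1 + lor X X) = a := by
    have := congrArg (fun x => lor x (α s)) hab
    simp only [lor_add_left, lor_smul_left, hXα, h6, h5, h3] at this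
    linarith
  have hb : b = 0 := by
    have := congrArg (fun x => lor x (N s)) hab
    simp only [lor_add_left, lor_smul_left, hXN, h7, hN.unit s hs, h4] at this
    linarith
  refine ⟨d, ?_⟩
  rw [ha, hb, zero_smul, add_zero] at hab
  exact add_left_cancel hab

end RuledSurface

theorem mainTheorem1 (I : Set ℝ) (hI : IsOpen I) (hI' : I.OrdConnected)
    (α N : ℝ → Mink) (hα : IsImmersedCurve I α) (hN : IsUnitNormalField I α N)
    (f : ℝ → ℝ → Mink) (hf : IsRuledSurface I α N f) :
    (IsDevelopable I f ↔ IsRM I α N) ∧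
      (IsRM I α N ↔ ∀ s ∈ I, ∃ c : ℝ, covDeriv α N s = c • deriv α s) := by
  have hRM : IsRM I α N ↔ ∀ s ∈ I, ∃ c : ℝ, covDeriv α N s = c • deriv α s :=
    isRM_iff_exists_smul hI hα
  refine ⟨?_, hRM⟩
  rw [hRM]
  constructor
  · intro hdev s hs
    rw [covDeriv_eq_deriv hI hα hN hs]
    exact hdev.exists_deriv_eq_smul hf hI hα hN hs
  · intro h
    refine isDevelopable_of_deriv_eq_smul hf hI hα hN fun s hs => ?_
    rw [← covDeriv_eq_deriv hI hα hN hs]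
    exact h s hs
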